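/- \textbf{Setting.} Let $(\mathcal X,P_X)$ be a probability space and $\mathcal H$ a reproducing kernel Hilbert space of real functions on $\mathcal X$ with $\mathcal H\subset L^2(P_X)$, whose kernel satisfies $K(x,x')=\sum_{j\ge1}\mu_j\phi_j(x)\phi_j(x')$ with $\mu_1\ge\mu_2\ge\dots\ge0$ and $(\phi_j)_{j\ge1}$ an orthonormal basis of $L^2(P_X)$ with $\sup_j\|\phi_j\|_{\sup}<\infty$. Let $x_1,x_2,\dots$ be i.i.d. with law $P_X$, write $\boldsymbol x=(x_1,\dots,x_n)$, and, given $\boldsymbol x$, let $y_i=f(x_i)+\epsilon_i$, $1\le i\le n$, with independent $\epsilon_i\sim N(0,\sigma^2)$, $\sigma>0$; $P_f(\cdot\mid\boldsymbol x)$ is the law of $\boldsymbol y=(y_1,\dots,y_n)$ given $\boldsymbol x$. Let $\boldsymbol K=(K(x_i,x_j)/n)_{i,j}$, with eigenvalues $\widehat\mu_1\ge\dots\ge\widehat\mu_n\ge0$, and for functions $g$ let $\|g\|_n^2=\frac1n\sum_{i\le n}g(x_i)^2$. Let $(\alpha_\tau)_{\tau\ge0}$ be step sizes, which may depend on $n$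 and $\boldsymbol x$, and $\eta_t=\sum_{\tau<t}\alpha_\tau$. Assume for all $n$ and $\boldsymbol x$: $(\alpha_\tau)$ is non-increasing; $0\le\alpha_\tau\le\min\{1,1/\widehat\mu_1\}$; $\eta_t\to\infty$ as $t\to\infty$; $\eta_{t_1}=o(\eta_{t_2})$ whenever $t_1=o(t_2)$, $t_2\to\infty$; and $\kappa_t:=\min\{j\ge 1:\mu_j<1/\eta_t\}-1\to\infty$ as $t\to\infty$. Gradient descent is $\boldsymbol f_0=0$, $\boldsymbol f_{t+1}=\boldsymbol f_t-\alpha_t\boldsymbol K(\boldsymbol f_t-\boldsymbol y)$, and $D_{n,t}=\frac1n\sum_{i\le n}(\boldsymbol f_t)_i^2$. Let $\mu_{n,t}$ and $\sigma_{n,t}^2$ be the mean and the variance of $D_{n,t}$ given $\boldsymbol x$ when $f=0$. For a level $\alpha\in(0,1)$, the test is $\phi_{n,t}=1$ if $|D_{n,t}-\mu_{n,t}|\ge z_{1-\alpha/2}\,\sigma_{n,t}$ and $\phi_{n,t}=0$ otherwise, where $z_p$ is the standard normal $p$-quantile. Put, for $\eta_t>0$, $$d_{n,t}^2=\frac1{\eta_t}+\sigma_{n,t},\qquad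 s_{n,t}=\frac1n\sqrt{\sum_{i=1}^n\min\{1,\eta_t\widehat\mu_i\}},\qquad r_{n,t}^2=\frac1{\eta_t}+s_{n,t},$$ and $T^*=\min\{t:\eta_t>0,\ 1/\eta_t<\sigma s_{n,t}\}$ if this set is non-empty. \textbf{Theorem 2.} (a) There is a constant $c>0$ such that for every level $\alpha\in(0,1)$, every radius $R>0$ and every $\varepsilon>0$ there are a real number $C_\varepsilon>0$ and positive integers $t_\varepsilon,N_\varepsilon$ with the following property. For every $T\ge t_\varepsilon$ there is an event $E$ of design sequences with $\Pr(E)>1-e^{-c\kappa_T}$ (for every $n\ge N_\varepsilon$ and every value of the design, if $\kappa_T$ depends on these) on which $$\inf_{t\ge T}\ \inf_{n\ge N_\varepsilon}\ \inf_{\substack{f\in\mathcal H,\ \|f\|_{\mathcal H}\le R\\ \|f\|_n\ge C_\varepsilon d_{n,t}}}P_f(\phi_{n,t}=1\mid\boldsymbol x)\ \ge\ 1-\varepsilon .$$ (b) Almost surely $T^*$ exists for every $n\ge1$, and the order of the separation rate is minimal at $T^*$: there is a constant $C_0>0$ such that $r_{n,T^*}\le C_0\,r_{n,t}$ for all $n,t\ge1$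 and all designs for which $T^*$ exists; and for every $M>0$ there is a constant $C_1>0$ such that $d_{n,T^*}\le C_1\,d_{n,t}$ for all $n,t\ge1$ and all designs for which $T^*$ exists and $s_{n,T^*}\le M\,\sigma_{n,T^*}$. -/

import Mathlib

open MeasureTheory ProbabilityTheory Filter
open scoped Matrix

noncomputable section

namespace GDTest

/-- The scalar reproducing kernel `K(x, y)` of a real reproducing kernel Hilbert space `H` of
functions on `𝒳` (the entry of Mathlib's operator-valued kernel, evaluated at `1`). -/
def kern {𝒳 : Type*} (H : Type*) [NormedAddCommGroup H] [InnerProductSpace ℝ H]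
    [CompleteSpace H] [RKHS ℝ H 𝒳 ℝ] (x y : 𝒳) : ℝ :=
  RKHS.kernel H x y 1

theorem kern_symm {𝒳 : Type*} (H : Type*) [NormedAddCommGroup H] [InnerProductSpace ℝ H]
    [CompleteSpace H] [RKHS ℝ H 𝒳 ℝ] (x y : 𝒳) : kern H x y = kern H y x := by
  have h1 := RKHS.kernel_inner (𝕜 := ℝ) H x y (1 : ℝ) (1 : ℝ)
  have h2 := RKHS.kernel_inner (𝕜 := ℝ) H y x (1 : ℝ) (1 : ℝ)
  have h3 := real_inner_comm (RKHS.kerFun H x (1 : ℝ)) (RKHS.kerFun H y (1 : ℝ))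
  have h4 := h1.trans (h3.trans h2.symm)
  simpa [kern] using h4

/-- A spectral expansion `K(x, y) = ∑ μ_i φ_i(x) φ_i(y)` of the kernel of `H` with respect to the
probability measure `P`: the functions `φ_i` form an orthonormal basis of `L²(P)`, and the
eigenvalues `μ_0 ≥ μ_1 ≥ ⋯ ≥ 0` are numbered from `0`. -/
structure SpectralExpansion {𝒳 : Type*} [MeasurableSpace 𝒳] (H : Type*) [NormedAddCommGroup H]
    [InnerProductSpace ℝ H] [CompleteSpace H] [RKHS ℝ H 𝒳 ℝ] (P : Measure 𝒳) where
  /-- the eigenvalues -/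
  μ : ℕ → ℝ
  /-- the eigenfunctions -/
  φ : ℕ → 𝒳 → ℝ
  /-- the classes of the eigenfunctions in `L²(P)` -/
  basis : HilbertBasis ℕ ℝ (Lp ℝ 2 P)
  basis_ae : ∀ i, basis i =ᵐ[P] φ i
  antitone : Antitone μ
  nonneg : ∀ i, 0 ≤ μ i
  expansion : ∀ x y, HasSum (fun i => μ i * φ i x * φ i y) (kern H x y)

/-- The total step size `η_t = ∑_{τ < t} α_τ`. -/
def totalStep (α : ℕ → ℝ) (t : ℕ) : ℝ := ∑ τ ∈ Finset.range t, α τ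

/-- `κ_t = min {j ≥ 1 : μ_j < 1 / η_t} - 1` for eigenvalues numbered from `1`; with eigenvalues
numbered from `0`, as here, the subtraction of `1` disappears. -/
def kappa (μ : ℕ → ℝ) (α : ℕ → ℝ) (t : ℕ) : ℕ := sInf {j : ℕ | μ j < 1 / totalStep α t}

/-- The empirical kernel matrix with entries `K(x_i, x_j) / n`. -/
def empKernel {𝒳 : Type*} (H : Type*) [NormedAddCommGroup H] [InnerProductSpace ℝ H]
    [CompleteSpace H] [RKHS ℝ H 𝒳 ℝ] {n : ℕ} (x : Fin n → 𝒳) : Matrix (Fin n) (Fin n) ℝ :=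
  Matrix.of fun i j => (1 / (n : ℝ)) * kern H (x i) (x j)

theorem empKernel_isHermitian {𝒳 : Type*} (H : Type*) [NormedAddCommGroup H]
    [InnerProductSpace ℝ H] [CompleteSpace H] [RKHS ℝ H 𝒳 ℝ] {n : ℕ} (x : Fin n → 𝒳) :
    (empKernel H x).IsHermitian := by
  ext i j
  simp [empKernel, kern_symm H (x i) (x j)]

/-- The eigenvalues of the empirical kernel matrix, with multiplicity. Their numbering plays no
role below. -/
def empEig {𝒳 : Type*} (H : Type*) [NormedAddCommGroup H] [InnerProductSpace ℝ H]
    [CompleteSpace H] [RKHS ℝ H 𝒳 ℝ] {n : ℕ} (x : Fin n → 𝒳) : Fin n → ℝ :=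
  (empKernel_isHermitian H x).eigenvalues

/-- Admissible step sizes for the design `x`. The conditions `le_one` and `mul_eig_le` together
say `α_τ ≤ min {1, 1 / μ̂_1}` for the largest empirical eigenvalue `μ̂_1` (with `1 / 0 = ∞`). -/
structure IsStepSizes {𝒳 : Type*} (H : Type*) [NormedAddCommGroup H] [InnerProductSpace ℝ H]
    [CompleteSpace H] [RKHS ℝ H 𝒳 ℝ] {n : ℕ} (x : Fin n → 𝒳) (α : ℕ → ℝ) : Prop where
  antitone : Antitone α
  nonneg : ∀ τ, 0 ≤ α τ
  le_one : ∀ τ, α τ ≤ 1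
  mul_eig_le : ∀ τ i, α τ * empEig H x i ≤ 1
  diverges : Tendsto (totalStep α) atTop atTop
  /-- `t₁ ≪ t₂` implies `η_{t₁} ≪ η_{t₂}` as `t₂ → ∞` -/
  slow : ∀ s : ℕ → ℕ, (fun t => (s t : ℝ)) =o[atTop] (fun t => (t : ℝ)) →
    (fun t => totalStep α (s t)) =o[atTop] totalStep α

/-- The squared empirical norm `(1 / n) ∑ v_i²`. -/
def empSqNorm {n : ℕ} (v : Fin n → ℝ) : ℝ := (1 / (n : ℝ)) * ∑ i, v i ^ 2

/-- The empirical norm `‖f‖_n` of a function at the design `x`. -/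
def empNorm {𝒳 : Type*} {n : ℕ} (x : Fin n → 𝒳) (f : 𝒳 → ℝ) : ℝ :=
  √(empSqNorm fun i => f (x i))

/-- Functional gradient descent for the least squares loss, started at `0`, recorded at the
design points: `f_{t+1} = f_t - α_t 𝐊 (f_t - y)`. -/
def gdIter {𝒳 : Type*} (H : Type*) [NormedAddCommGroup H] [InnerProductSpace ℝ H]
    [CompleteSpace H] [RKHS ℝ H 𝒳 ℝ] {n : ℕ} (x : Fin n → 𝒳) (α : ℕ → ℝ) (y : Fin n → ℝ) :
    ℕ → Fin n → ℝ
  | 0 => 0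
  | t + 1 => gdIter H x α y t - α t • (empKernel H x *ᵥ (gdIter H x α y t - y))

/-- The test statistic `D_{n,t} = ‖f_t‖_n²` as a function of the responses `y`. -/
def testStat {𝒳 : Type*} (H : Type*) [NormedAddCommGroup H] [InnerProductSpace ℝ H]
    [CompleteSpace H] [RKHS ℝ H 𝒳 ℝ] {n : ℕ} (x : Fin n → 𝒳) (α : ℕ → ℝ) (t : ℕ)
    (y : Fin n → ℝ) : ℝ :=
  empSqNorm (gdIter H x α y t)

/-- The conditional law, given the design `x`, of the responses `y_i = f(x_i) + ε_i` with
independent noise `ε_i ∼ N(0, σ²)`. -/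
def obsLaw {𝒳 : Type*} (σ : ℝ) {n : ℕ} (x : Fin n → 𝒳) (f : 𝒳 → ℝ) : Measure (Fin n → ℝ) :=
  Measure.pi fun i => gaussianReal (f (x i)) (Real.toNNReal (σ ^ 2))

/-- `μ_{n,t} = E_{H₀}[D_{n,t} | x]`. -/
def nullMean {𝒳 : Type*} (H : Type*) [NormedAddCommGroup H] [InnerProductSpace ℝ H]
    [CompleteSpace H] [RKHS ℝ H 𝒳 ℝ] (σ : ℝ) {n : ℕ} (x : Fin n → 𝒳) (α : ℕ → ℝ) (t : ℕ) : ℝ :=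
  ∫ y, testStat H x α t y ∂(obsLaw σ x 0)

/-- `σ_{n,t}`, the square root of `σ_{n,t}² = Var_{H₀}[D_{n,t} | x]`. -/
def nullSd {𝒳 : Type*} (H : Type*) [NormedAddCommGroup H] [InnerProductSpace ℝ H]
    [CompleteSpace H] [RKHS ℝ H 𝒳 ℝ] (σ : ℝ) {n : ℕ} (x : Fin n → 𝒳) (α : ℕ → ℝ) (t : ℕ) : ℝ :=
  √(variance (testStat H x α t) (obsLaw σ x 0))

/-- The `p`-quantile of the standard normal distribution, for `0 < p < 1`. -/
def stdNormalQuantile (p : ℝ) : ℝ := sInf {z : ℝ | p ≤ cdf (gaussianReal 0 1) z}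

/-- The test `φ_{n,t}` at level `a`: it takes the value `1` (rejection) if
`|D_{n,t} - μ_{n,t}| ≥ z_{1-a/2} σ_{n,t}`, and `0` otherwise. -/
def test {𝒳 : Type*} (H : Type*) [NormedAddCommGroup H] [InnerProductSpace ℝ H]
    [CompleteSpace H] [RKHS ℝ H 𝒳 ℝ] (σ a : ℝ) {n : ℕ} (x : Fin n → 𝒳) (α : ℕ → ℝ) (t : ℕ) :
    (Fin n → ℝ) → ℝ :=
  Set.indicator {y | stdNormalQuantile (1 - a / 2) * nullSd H σ x α t ≤
    |testStat H x α t y - nullMean H σ x α t|} 1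

/-- The power `P_f(φ_{n,t} = 1 | x)`. -/
def power {𝒳 : Type*} (H : Type*) [NormedAddCommGroup H] [InnerProductSpace ℝ H]
    [CompleteSpace H] [RKHS ℝ H 𝒳 ℝ] (σ a : ℝ) {n : ℕ} (x : Fin n → 𝒳) (α : ℕ → ℝ) (t : ℕ)
    (f : 𝒳 → ℝ) : ℝ :=
  (obsLaw σ x f).real {y | test H σ a x α t y = 1}

/-- The separation rate `d_{n,t}`, with `d_{n,t}² = 1 / η_t + σ_{n,t}` (meaningful if `η_t > 0`). -/
def sepRate {𝒳 : Type*} (H : Type*) [NormedAddCommGroup H] [InnerProductSpace ℝ H]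
    [CompleteSpace H] [RKHS ℝ H 𝒳 ℝ] (σ : ℝ) {n : ℕ} (x : Fin n → 𝒳) (α : ℕ → ℝ) (t : ℕ) : ℝ :=
  √(1 / totalStep α t + nullSd H σ x α t)

/-- The order `(1 / n) √(∑_i min {1, η_t μ̂_i})` of the standard deviation of `D_{n,t}`, as it
appears in the stopping rule. -/
def sdOrder {𝒳 : Type*} (H : Type*) [NormedAddCommGroup H] [InnerProductSpace ℝ H]
    [CompleteSpace H] [RKHS ℝ H 𝒳 ℝ] {n : ℕ} (x : Fin n → 𝒳) (α : ℕ → ℝ) (t : ℕ) : ℝ :=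
  (1 / (n : ℝ)) * √(∑ i, min 1 (totalStep α t * empEig H x i))

/-- The separation rate in its explicit form, the square root of
`1 / η_t + (1 / n) √(∑_i min {1, η_t μ̂_i})` (meaningful if `η_t > 0`). -/
def sepOrder {𝒳 : Type*} (H : Type*) [NormedAddCommGroup H] [InnerProductSpace ℝ H]
    [CompleteSpace H] [RKHS ℝ H 𝒳 ℝ] {n : ℕ} (x : Fin n → 𝒳) (α : ℕ → ℝ) (t : ℕ) : ℝ :=
  √(1 / totalStep α t + sdOrder H x α t)

/-- The times at which the bias bound `1 / η_t` is smaller than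
`(σ / n) √(∑_i min {1, η_t μ̂_i})`; a time with `η_t = 0` is not among them. -/
def stopSet {𝒳 : Type*} (H : Type*) [NormedAddCommGroup H] [InnerProductSpace ℝ H]
    [CompleteSpace H] [RKHS ℝ H 𝒳 ℝ] (σ : ℝ) {n : ℕ} (x : Fin n → 𝒳) (α : ℕ → ℝ) : Set ℕ :=
  {t | 0 < totalStep α t ∧ 1 / totalStep α t < σ * sdOrder H x α t}

/-- The stopping time `T*`, the least element of `stopSet` (if that is non-empty). -/
def stopTime {𝒳 : Type*} (H : Type*) [NormedAddCommGroup H] [InnerProductSpace ℝ H]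
    [CompleteSpace H] [RKHS ℝ H 𝒳 ℝ] (σ : ℝ) {n : ℕ} (x : Fin n → 𝒳) (α : ℕ → ℝ) : ℕ :=
  sInf (stopSet H σ x α)

end GDTest

end

noncomputable section

namespace GDTest

/-! ### Moments of Gaussian quadratic forms. -/

section GaussianQuadratic

open scoped NNReal

/-! In the eigenbasis of the empirical kernel matrix, gradient descent multiplies the k-th
coordinate of `y` by 1 - ρ_k, where ρ_k = ∏_{τ<t} (1 - α_τ μ̂_k) lies in [0, 1] and ρ_k ≤ 1 / (1 +
η_t μ̂_k). So D_{n,t} is a diagonal quadratic form in independent Gaussians (`testStat_moments`),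
with explicit mean and variance.

The power bound is deterministic. Under `f` the mean of D_{n,t} rises by A = (1/n) ∑ (1 - ρ_k)²
c_k², with c_k the coordinates of `f` at the design. A Bessel inequality in `H`
(`sum_mul_coord_sq_le`) bounds the lost part (1/n) ∑ ρ_k² c_k² by ‖f‖² / η_t, so separation forces A
≥ L σ_{n,t} with L large (`le_meanShift`). The variance is at most σ_{n,t}² + 4σ²A/n, and Chebyshev
applies once σ²/n is of order at most σ_{n,t}. This holds if some μ̂_k ≥ 1/η_t (`le_nullSd`); if
there is none, ‖f‖_n² ≤ ‖f‖²/η_t and `f` is not separated (`exists_large_eigenvalue`). Hence in (a)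
the event can be the whole space.

For (b), 1/η_t decreases and s_{n,t} increases in t, and s at most doubles in one step from t ≥ 1.
At T* the two terms have just crossed, so neither an earlier nor a later time improves the order of
their sum. T* exists once some μ̂_k > 0: κ_t → ∞ makes all μ_j positive, hence K(x, x) > 0 almost
everywhere, and the trace of the empirical matrix is positive. -/

lemma memLp_pow_gaussianReal (m : ℝ) (v : ℝ≥0) (k : ℕ) :
    MemLp (fun x : ℝ => x ^ k) 2 (gaussianReal m v) := by
  rcases Nat.eq_zero_or_pos k with rfl | hk
  · simpa using memLp_const (1 : ℝ)
  have h := (memLp_id_gaussianReal' (μ := m) (v := v) (2 * k)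
    (ENNReal.mul_ne_top (by simp) (by simp))).norm_rpow_div (k : ENNReal)
  have h2 : (2 * (k : ENNReal)) / k = 2 :=
    ENNReal.mul_div_cancel_right (by exact_mod_cast hk.ne') (by simp)
  rw [h2] at h
  refine h.of_le (by fun_prop) (ae_of_all _ fun x => ?_)
  simp

/-- The moments are derivatives at 0 of the moment generating function. Each derivative is a
polynomial p times the same exponential, and `step` is the recursion p ↦ p' + p (m + v t). -/
lemma integral_pow_gaussianReal (m : ℝ) (v : ℝ≥0) :
    (∫ x, x ^ 2 ∂gaussianReal m v) = m ^ 2 + v ∧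
      (∫ x, x ^ 4 ∂gaussianReal m v) = m ^ 4 + 6 * m ^ 2 * v + 3 * v ^ 2 := by
  have h0 : (0 : ℝ) ∈ interior (integrableExpSet id (gaussianReal m v)) := by simp
  have e (k : ℕ) : (∫ x, x ^ k ∂gaussianReal m v) =
      iteratedDeriv k (fun t : ℝ => Real.exp (m * t + v * t ^ 2 / 2)) 0 := by
    rw [← mgf_id_gaussianReal, iteratedDeriv_mgf_zero h0]
    rfl
  have hE (t : ℝ) : HasDerivAt (fun t : ℝ => Real.exp (m * t + v * t ^ 2 / 2))
      ((m + v * t) * Real.exp (m * t + v * t ^ 2 / 2)) t := by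
    have h1 : HasDerivAt (fun t : ℝ => m * t + v * t ^ 2 / 2) (m + v * t) t := by
      have := ((hasDerivAt_id t).const_mul m).add
        ((((hasDerivAt_id t).pow 2).const_mul (v : ℝ)).div_const 2)
      refine this.congr_deriv ?_
      simp
      ring
    simpa [mul_comm] using h1.exp
  have step (p p' : ℝ → ℝ) (hp : ∀ t, HasDerivAt p (p' t) t) :
      deriv (fun t => p t * Real.exp (m * t + v * t ^ 2 / 2)) =
        fun t => (p' t + p t * (m + v * t)) * Real.exp (m * t + v * t ^ 2 / 2) := by
    funext t
    refine HasDerivAt.deriv (((hp t).mul (hE t)).congr_deriv ?_)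
    ring
  have hl (t : ℝ) : HasDerivAt (fun t : ℝ => m + v * t) v t := by
    simpa using ((hasDerivAt_id t).const_mul (v : ℝ)).const_add m
  have d1 : deriv (fun t : ℝ => Real.exp (m * t + v * t ^ 2 / 2)) =
      fun t => (m + v * t) * Real.exp (m * t + v * t ^ 2 / 2) := funext fun t => (hE t).deriv
  have d2 := step (fun t => m + v * t) (fun _ => v) hl
  have d3 := step (fun t => v + (m + v * t) * (m + v * t))
    (fun t => v * (m + v * t) + (m + v * t) * v) (fun t => ((hl t).mul (hl t)).const_add _)
  have d4 := step
    (fun t => v * (m + v * t) + (m + v * t) * v + (v + (m + v * t) * (m + v * t)) * (m + v * t))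
    (fun t => (v * v + v * v) +
      ((v * (m + v * t) + (m + v * t) * v) * (m + v * t) + (v + (m + v * t) * (m + v * t)) * v))
    (fun t => (((hl t).const_mul _).add ((hl t).mul_const _)).add
      ((((hl t).mul (hl t)).const_add _).mul (hl t)))
  refine ⟨?_, ?_⟩
  · rw [e 2, iteratedDeriv_eq_iterate]
    simp only [Function.iterate_succ, Function.iterate_zero, Function.comp, id]
    rw [d1, d2]
    simp
    ring
  · rw [e 4, iteratedDeriv_eq_iterate]
    simp only [Function.iterate_succ, Function.iterate_zero, Function.comp, id]
    rw [d1, d2, d3, d4]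
    simp
    ring

lemma variance_sq_gaussianReal (m : ℝ) (v : ℝ≥0) :
    variance (fun x => x ^ 2) (gaussianReal m v) = 4 * m ^ 2 * v + 2 * v ^ 2 := by
  rw [variance_eq_sub (memLp_pow_gaussianReal m v 2)]
  have h := integral_pow_gaussianReal m v
  have h4 : ∫ x, ((fun x : ℝ => x ^ 2) ^ 2) x ∂gaussianReal m v = ∫ x, x ^ 4 ∂gaussianReal m v := by
    congr with x
    simp [← pow_mul]
  rw [h4, h.1, h.2]
  ring

variable {ι : Type*} [Fintype ι] [DecidableEq ι]

/-- The coordinates of a Gaussian vector with independent components of equal variance in an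
orthonormal basis are independent Gaussians of the same variance. -/
lemma orthonormal_coord_gaussian (m : ι → ℝ) (v : ℝ≥0) (V : ι → ι → ℝ)
    (hV : ∀ k l, ∑ i, V k i * V l i = if k = l then 1 else 0) :
    iIndepFun (fun k (y : ι → ℝ) => ∑ i, V k i * y i)
        (Measure.pi fun i => gaussianReal (m i) v) ∧
      ∀ k, (Measure.pi fun i => gaussianReal (m i) v).map (fun y => ∑ i, V k i * y i) =
        gaussianReal (∑ i, V k i * m i) v := by
  set ν := Measure.pi fun i => gaussianReal (m i) v with hν
  have hmap (i : ι) : ν.map (fun y : ι → ℝ => y i) = gaussianReal (m i) v :=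
    (measurePreserving_eval (fun i => gaussianReal (m i) v) i).map_eq
  have hind : iIndepFun (fun i (y : ι → ℝ) => y i) ν :=
    iIndepFun_pi (μ := fun i => gaussianReal (m i) v) (X := fun _ x => x) (fun _ => aemeasurable_id)
  have hev (i : ι) : HasGaussianLaw (fun y : ι → ℝ => y i) ν :=
    ⟨by rw [hmap]; infer_instance⟩
  have hid : HasGaussianLaw (fun y : ι → ℝ => fun i => y i) ν := hind.hasGaussianLaw hev
  let A : (ι → ℝ) →L[ℝ] (ι → ℝ) :=
    ContinuousLinearMap.pi fun k => ∑ i, V k i • ContinuousLinearMap.proj i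
  have hA : HasGaussianLaw (fun y : ι → ℝ => fun k => ∑ i, V k i * y i) ν := by
    have e : (fun y : ι → ℝ => fun k => ∑ i, V k i * y i) = fun y => A fun i => y i := by
      funext y k
      simp [A]
    rw [e]
    exact hid.map_fun A
  have hLp (i : ι) : MemLp (fun y : ι → ℝ => y i) 2 ν := (hev i).memLp_two
  have hcov0 (i j : ι) : cov[fun y : ι → ℝ => y i, fun y => y j; ν] = if i = j then (v : ℝ) else 0 := by
    split_ifs with h
    · subst h
      rw [covariance_self (Measurable.aemeasurable (by fun_prop))]
      have := variance_map (μ := ν) (X := id) (Y := fun y : ι → ℝ => y i)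
        aemeasurable_id (Measurable.aemeasurable (by fun_prop))
      rw [hmap, variance_id_gaussianReal] at this
      exact this.symm
    · exact (hind.indepFun h).covariance_eq_zero (hLp i) (hLp j)
  have hcov (k l : ι) : cov[fun y : ι → ℝ => ∑ i, V k i * y i, fun y => ∑ i, V l i * y i; ν] =
      if k = l then (v : ℝ) else 0 := by
    rw [covariance_fun_sum_fun_sum (fun i => (hLp i).const_mul _) (fun i => (hLp i).const_mul _)]
    simp_rw [covariance_const_mul_left, covariance_const_mul_right, hcov0]
    simp only [mul_ite, mul_zero, Finset.sum_ite_eq, Finset.mem_univ, if_true]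
    simp_rw [← mul_assoc]
    rw [← Finset.sum_mul, hV]
    split_ifs <;> simp
  -- The coordinates are jointly Gaussian, so vanishing covariances give independence.
  refine ⟨hA.iIndepFun_of_covariance_eq_zero fun i j hij => by rw [hcov, if_neg hij], fun k => ?_⟩
  have hk : HasGaussianLaw (fun y : ι → ℝ => ∑ i, V k i * y i) ν := hA.eval k
  rw [hk.map_eq_gaussianReal]
  congr 1
  · rw [integral_finsetSum _ fun i _ => ((hev i).integrable).const_mul _]
    refine Finset.sum_congr rfl fun i _ => ?_
    rw [integral_const_mul]
    congr 1
    have := integral_map (μ := ν) (φ := fun y : ι → ℝ => y i) (f := fun x : ℝ => x)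
      (Measurable.aemeasurable (by fun_prop)) (by fun_prop)
    rw [hmap, integral_id_gaussianReal] at this
    exact this.symm
  · rw [← covariance_self (Measurable.aemeasurable (by fun_prop)), hcov k k]
    simp

/-- Mean and variance of a quadratic form that is diagonal in the orthonormal basis `V`, under a
Gaussian law with independent components. -/
lemma quadratic_gaussian (m : ι → ℝ) (v : ℝ≥0) (V : ι → ι → ℝ)
    (hV : ∀ k l, ∑ i, V k i * V l i = if k = l then 1 else 0) (w : ι → ℝ) :
    MemLp (fun y : ι → ℝ => ∑ k, w k * (∑ i, V k i * y i) ^ 2) 2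
        (Measure.pi fun i => gaussianReal (m i) v) ∧
      ∫ y, ∑ k, w k * (∑ i, V k i * y i) ^ 2 ∂(Measure.pi fun i => gaussianReal (m i) v) =
        ∑ k, w k * ((∑ i, V k i * m i) ^ 2 + v) ∧
      variance (fun y : ι → ℝ => ∑ k, w k * (∑ i, V k i * y i) ^ 2)
          (Measure.pi fun i => gaussianReal (m i) v) =
        ∑ k, w k ^ 2 * (4 * (∑ i, V k i * m i) ^ 2 * v + 2 * v ^ 2) := by
  obtain ⟨hind, hmap⟩ := orthonormal_coord_gaussian m v V hV
  set ν := Measure.pi fun i => gaussianReal (m i) v with hν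
  have hL (k : ι) : MemLp (fun y : ι → ℝ => (∑ i, V k i * y i) ^ 2) 2 ν := by
    have := memLp_pow_gaussianReal (∑ i, V k i * m i) v 2
    rw [← hmap k] at this
    exact this.comp_of_map (Measurable.aemeasurable (by fun_prop))
  have hsq : iIndepFun (fun k (y : ι → ℝ) => w k * (∑ i, V k i * y i) ^ 2) ν :=
    hind.comp (fun k x => w k * x ^ 2) fun k => by fun_prop
  refine ⟨memLp_finsetSum _ fun k _ => (hL k).const_mul _, ?_, ?_⟩
  · rw [integral_finsetSum _ fun k _ => ((hL k).integrable (by simp)).const_mul _]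
    refine Finset.sum_congr rfl fun k _ => ?_
    rw [integral_const_mul, ← (integral_pow_gaussianReal _ v).1, ← hmap k,
      integral_map (Measurable.aemeasurable (by fun_prop)) (by fun_prop)]
  · have h := IndepFun.variance_sum (s := Finset.univ) (μ := ν)
      (X := fun k (y : ι → ℝ) => w k * (∑ i, V k i * y i) ^ 2)
      (fun k _ => (hL k).const_mul _) (fun i _ j _ hij => hsq.indepFun hij)
    have e : (∑ k, fun y : ι → ℝ => w k * (∑ i, V k i * y i) ^ 2) =
        fun y : ι → ℝ => ∑ k, w k * (∑ i, V k i * y i) ^ 2 := by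
      ext y
      simp
    rw [e] at h
    rw [h]
    refine Finset.sum_congr rfl fun k _ => ?_
    rw [variance_const_mul, ← variance_sq_gaussianReal, ← hmap k,
      variance_map (by fun_prop) (Measurable.aemeasurable (by fun_prop))]
    rfl

end GaussianQuadratic

/-! ### Bounds for the residual polynomial. -/

section Filter

/-- The residual polynomial `∏_{τ < t} (1 - α_τ u)` of gradient descent. -/
def residual (α : ℕ → ℝ) (t : ℕ) (u : ℝ) : ℝ := ∏ τ ∈ Finset.range t, (1 - α τ * u)

lemma residual_succ (α : ℕ → ℝ) (t : ℕ) (u : ℝ) :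
    residual α (t + 1) u = residual α t u * (1 - α t * u) := Finset.prod_range_succ ..

lemma totalStep_succ (α : ℕ → ℝ) (t : ℕ) : totalStep α (t + 1) = totalStep α t + α t :=
  Finset.sum_range_succ ..

variable {α : ℕ → ℝ} {u : ℝ}

lemma totalStep_mono (h0 : ∀ τ, 0 ≤ α τ) : Monotone (totalStep α) :=
  monotone_nat_of_le_succ fun t => by rw [totalStep_succ]; linarith [h0 t]

lemma totalStep_nonneg (h0 : ∀ τ, 0 ≤ α τ) (t : ℕ) : 0 ≤ totalStep α t :=
  Finset.sum_nonneg fun τ _ => h0 τ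

lemma residual_nonneg (h1 : ∀ τ, α τ * u ≤ 1) (t : ℕ) : 0 ≤ residual α t u :=
  Finset.prod_nonneg fun τ _ => by linarith [h1 τ]

lemma residual_antitone (h0 : ∀ τ, 0 ≤ α τ) (hu : 0 ≤ u) (h1 : ∀ τ, α τ * u ≤ 1) :
    Antitone fun t => residual α t u :=
  antitone_nat_of_succ_le fun t => by
    rw [residual_succ]
    exact mul_le_of_le_one_right (residual_nonneg h1 t) (by linarith [mul_nonneg (h0 t) hu])

lemma residual_le_one (h0 : ∀ τ, 0 ≤ α τ) (hu : 0 ≤ u) (h1 : ∀ τ, α τ * u ≤ 1) (t : ℕ) :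
    residual α t u ≤ 1 := by
  simpa [residual] using residual_antitone h0 hu h1 (Nat.zero_le t)

/-- The linear bound is the Bernoulli inequality ∏ (1 - a_τ) ≥ 1 - ∑ a_τ. -/
lemma one_sub_residual_le (h0 : ∀ τ, 0 ≤ α τ) (hu : 0 ≤ u) (h1 : ∀ τ, α τ * u ≤ 1) (t : ℕ) :
    1 - residual α t u ≤ min 1 (totalStep α t * u) := by
  refine le_min (by linarith [residual_nonneg h1 t]) ?_
  induction t with
  | zero => simp [residual, totalStep]
  | succ t ih =>
    rw [residual_succ, totalStep_succ]
    nlinarith [mul_le_mul_of_nonneg_right (residual_le_one h0 hu h1 t) (mul_nonneg (h0 t) hu)]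

lemma residual_le_exp (h1 : ∀ τ, α τ * u ≤ 1) (t : ℕ) :
    residual α t u ≤ Real.exp (-(totalStep α t * u)) := by
  rw [totalStep, Finset.sum_mul, ← Finset.sum_neg_distrib, Real.exp_sum]
  exact Finset.prod_le_prod (fun τ _ => by linarith [h1 τ]) fun τ _ => Real.one_sub_le_exp_neg _

/-- Combines ρ ≤ exp(-s) with 1 + s ≤ exp(s) for s = η_t u. It controls the bias and also gives ρ ≤
1/2 as soon as s ≥ 1. -/
lemma residual_mul_le (h0 : ∀ τ, 0 ≤ α τ) (hu : 0 ≤ u) (h1 : ∀ τ, α τ * u ≤ 1) (t : ℕ) :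
    residual α t u * (1 + totalStep α t * u) ≤ 1 := by
  have h := residual_le_exp h1 t
  have h2 := Real.add_one_le_exp (totalStep α t * u)
  have h3 : 0 ≤ 1 + totalStep α t * u := by
    have := mul_nonneg (totalStep_nonneg h0 t) hu
    linarith
  calc residual α t u * (1 + totalStep α t * u)
      ≤ Real.exp (-(totalStep α t * u)) * Real.exp (totalStep α t * u) :=
        mul_le_mul h (by linarith) h3 (Real.exp_pos _).le
    _ = 1 := by rw [← Real.exp_add]; simp

lemma residual_sq_mul_le (h0 : ∀ τ, 0 ≤ α τ) (hu : 0 ≤ u) (h1 : ∀ τ, α τ * u ≤ 1) (t : ℕ)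
    (ht : 0 < totalStep α t) : residual α t u ^ 2 * u ≤ 1 / totalStep α t := by
  rw [le_div_iff₀ ht]
  have ha := residual_mul_le h0 hu h1 t
  have hb := residual_nonneg h1 t
  have hc := residual_le_one h0 hu h1 t
  have hd : 0 ≤ residual α t u * (totalStep α t * u) := by positivity
  nlinarith [mul_le_mul_of_nonneg_right hc hd]

end Filter

/-! ### Diagonalization by the empirical kernel matrix. -/

section Spectral

variable {𝒳 : Type*} (H : Type*) [NormedAddCommGroup H] [InnerProductSpace ℝ H]
    [CompleteSpace H] [RKHS ℝ H 𝒳 ℝ] {n : ℕ} (x : Fin n → 𝒳)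

/-- The `i`-th entry of the `k`-th eigenvector of the empirical kernel matrix. -/
def eigvec (k i : Fin n) : ℝ := (empKernel_isHermitian H x).eigenvectorBasis k i

/-- The coordinates of a vector in the eigenbasis of the empirical kernel matrix. -/
def coord (y : Fin n → ℝ) (k : Fin n) : ℝ := ∑ i, eigvec H x k i * y i

lemma eigvec_orthonormal (k l : Fin n) :
    ∑ i, eigvec H x k i * eigvec H x l i = if k = l then 1 else 0 := by
  have h := orthonormal_iff_ite.1 (empKernel_isHermitian H x).eigenvectorBasis.orthonormal k l
  rw [← h, PiLp.inner_apply]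
  simp [eigvec, mul_comm]

lemma sum_coord_sq (y : Fin n → ℝ) : ∑ k, coord H x y k ^ 2 = ∑ i, y i ^ 2 := by
  have h := (empKernel_isHermitian H x).eigenvectorBasis.sum_sq_norm_inner_right (WithLp.toLp 2 y)
  rw [EuclideanSpace.real_norm_sq_eq] at h
  rw [← h]
  refine Finset.sum_congr rfl fun k _ => ?_
  rw [PiLp.inner_apply, Real.norm_eq_abs, sq_abs]
  simp [coord, eigvec, mul_comm]

lemma sum_eigvec_mul_empKernel (k j : Fin n) :
    ∑ i, empKernel H x j i * eigvec H x k i = empEig H x k * eigvec H x k j :=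
  congrFun ((empKernel_isHermitian H x).mulVec_eigenvectorBasis k) j

lemma coord_empKernel_mulVec (y : Fin n → ℝ) (k : Fin n) :
    coord H x (empKernel H x *ᵥ y) k = empEig H x k * coord H x y k := by
  simp only [coord, Matrix.mulVec, dotProduct, Finset.mul_sum]
  rw [Finset.sum_comm]
  refine Finset.sum_congr rfl fun j _ => ?_
  rw [← mul_assoc, ← sum_eigvec_mul_empKernel, Finset.sum_mul]
  refine Finset.sum_congr rfl fun i _ => ?_
  have : empKernel H x i j = empKernel H x j i := by
    simp [empKernel, kern_symm H (x i) (x j)]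
  rw [this]
  ring

lemma coord_gdIter (α : ℕ → ℝ) (y : Fin n → ℝ) (t : ℕ) (k : Fin n) :
    coord H x (gdIter H x α y t) k = (1 - residual α t (empEig H x k)) * coord H x y k := by
  induction t with
  | zero => simp [gdIter, residual, coord]
  | succ t ih =>
    have h := coord_empKernel_mulVec H x (gdIter H x α y t - y) k
    have hsub (a b : Fin n → ℝ) : coord H x (a - b) k = coord H x a k - coord H x b k := by
      simp [coord, mul_sub]
    have hsmul (c : ℝ) (a : Fin n → ℝ) : coord H x (c • a) k = c * coord H x a k := by
      simp only [coord, Finset.mul_sum, Pi.smul_apply, smul_eq_mul]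
      exact Finset.sum_congr rfl fun i _ => by ring
    rw [gdIter, hsub, hsmul, h, hsub, ih, residual_succ]
    ring

lemma testStat_eq (α : ℕ → ℝ) (t : ℕ) (y : Fin n → ℝ) :
    testStat H x α t y =
      ∑ k, (1 / (n : ℝ) * (1 - residual α t (empEig H x k)) ^ 2) * coord H x y k ^ 2 := by
  rw [testStat, empSqNorm, ← sum_coord_sq H x, Finset.mul_sum]
  refine Finset.sum_congr rfl fun k _ => ?_
  rw [coord_gdIter]
  ring

/-- The element of `H` that represents the functional `f ↦ coord H x (f ∘ x) k`. -/
def eigfun (k : Fin n) : H := ∑ i, eigvec H x k i • RKHS.kerFun H (x i) (1 : ℝ)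

lemma inner_eigfun (f : H) (k : Fin n) :
    inner ℝ (eigfun H x k) f = coord H x (fun i => f (x i)) k := by
  simp [eigfun, coord, sum_inner, inner_smul_left]

/-- The kernel sections at the design have Gram matrix n𝐊, so its eigenvectors give orthogonal
elements of `H`. Null eigenvectors give the zero element. -/
lemma inner_eigfun_eigfun (k l : Fin n) :
    inner ℝ (eigfun H x k) (eigfun H x l) = if k = l then n * empEig H x k else 0 := by
  have hn : (n : ℝ) ≠ 0 := by
    have := k.pos
    positivity
  have e : (fun j => (eigfun H x l) (x j)) =
      fun j => (n : ℝ) * (empEig H x l * eigvec H x l j) := by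
    funext j
    have h1 : (eigfun H x l) (x j) = inner ℝ (eigfun H x l) (RKHS.kerFun H (x j) (1 : ℝ)) := by
      simp
    rw [h1, ← sum_eigvec_mul_empKernel, Finset.mul_sum, eigfun, sum_inner]
    refine Finset.sum_congr rfl fun i _ => ?_
    rw [inner_smul_left, ← RKHS.kernel_inner]
    simp only [empKernel, kern, Matrix.of_apply]
    field_simp
    simp [mul_comm]
  rw [inner_eigfun, e, coord]
  have : ∀ i, eigvec H x k i * ((n : ℝ) * (empEig H x l * eigvec H x l i)) =
      (n * empEig H x l) * (eigvec H x k i * eigvec H x l i) := fun i => by ring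
  simp_rw [this]
  rw [← Finset.mul_sum, eigvec_orthonormal]
  split_ifs with h
  · rw [h, mul_one]
  · rw [mul_zero]

lemma empEig_nonneg (k : Fin n) : 0 ≤ empEig H x k := by
  have h := inner_eigfun_eigfun H x k k
  rw [if_pos rfl] at h
  have h2 : 0 ≤ (n : ℝ) * empEig H x k := h ▸ real_inner_self_nonneg
  exact nonneg_of_mul_nonneg_right h2 (by exact_mod_cast k.pos)

variable {H} in
/-- A Bessel inequality for the values of a function of `H` at the design points. -/
lemma sum_mul_coord_sq_le (f : H) {w : Fin n → ℝ} (hw : ∀ k, 0 ≤ w k) {B : ℝ}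
    (hB : ∀ k, w k * empEig H x k ≤ B) :
    ∑ k, w k * coord H x (fun i => f (x i)) k ^ 2 ≤ n * B * ‖f‖ ^ 2 := by
  set c := coord H x (fun i => f (x i)) with hc
  set Q := ∑ k, w k * c k ^ 2 with hQ
  have hQ0 : 0 ≤ Q := Finset.sum_nonneg fun k _ => mul_nonneg (hw k) (sq_nonneg _)
  -- Duality: ⟨g, f⟩ = Q and ‖g‖² ≤ nBQ, so Cauchy–Schwarz gives Q² ≤ nBQ‖f‖². No division by
  -- eigenvalues occurs, so they may vanish.
  set g : H := ∑ k, (w k * c k) • eigfun H x k with hg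
  have h1 : inner ℝ g f = Q := by
    rw [hg, sum_inner]
    refine Finset.sum_congr rfl fun k _ => ?_
    rw [inner_smul_left, inner_eigfun, ← hc]
    simp
    ring
  have h2 : ‖g‖ ^ 2 ≤ n * B * Q := by
    rw [← real_inner_self_eq_norm_sq, hg, sum_inner, hQ, Finset.mul_sum]
    refine Finset.sum_le_sum fun k _ => ?_
    rw [inner_sum]
    simp_rw [inner_smul_left, inner_smul_right, inner_eigfun_eigfun]
    simp only [mul_ite, mul_zero, Finset.sum_ite_eq, Finset.mem_univ, if_true]
    have := mul_le_mul_of_nonneg_left (hB k)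
      (mul_nonneg (mul_nonneg (Nat.cast_nonneg (α := ℝ) n) (hw k)) (sq_nonneg (c k)))
    simp only [conj_trivial]
    nlinarith
  have h3 : Q ^ 2 ≤ n * B * Q * ‖f‖ ^ 2 := by
    have h := abs_real_inner_le_norm g f
    rw [h1, abs_of_nonneg hQ0] at h
    calc Q ^ 2 ≤ (‖g‖ * ‖f‖) ^ 2 := pow_le_pow_left₀ hQ0 h 2
      _ = ‖g‖ ^ 2 * ‖f‖ ^ 2 := mul_pow ..
      _ ≤ _ := mul_le_mul_of_nonneg_right h2 (sq_nonneg _)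
  rcases hQ0.eq_or_lt with h0 | h0
  · rw [← h0]
    rcases Nat.eq_zero_or_pos n with rfl | hn
    · simp
    · have : 0 ≤ B := (mul_nonneg (hw ⟨0, hn⟩) (empEig_nonneg H x ⟨0, hn⟩)).trans (hB _)
      positivity
  · refine le_of_mul_le_mul_right ?_ h0
    nlinarith

lemma empSqNorm_eq (y : Fin n → ℝ) : empSqNorm y = 1 / (n : ℝ) * ∑ k, coord H x y k ^ 2 := by
  rw [empSqNorm, sum_coord_sq]

/-- Moments of the test statistic under an arbitrary regression function. -/
lemma testStat_moments (σ : ℝ) (α : ℕ → ℝ) (t : ℕ) (f : 𝒳 → ℝ) :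
    MemLp (testStat H x α t) 2 (obsLaw σ x f) ∧
      ∫ y, testStat H x α t y ∂(obsLaw σ x f) =
        ∑ k, (1 / (n : ℝ) * (1 - residual α t (empEig H x k)) ^ 2) *
          (coord H x (fun i => f (x i)) k ^ 2 + σ ^ 2) ∧
      variance (testStat H x α t) (obsLaw σ x f) =
        ∑ k, (1 / (n : ℝ) * (1 - residual α t (empEig H x k)) ^ 2) ^ 2 *
          (4 * coord H x (fun i => f (x i)) k ^ 2 * σ ^ 2 + 2 * (σ ^ 2) ^ 2) := by
  have h := quadratic_gaussian (fun i => f (x i)) (Real.toNNReal (σ ^ 2)) (eigvec H x)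
    (eigvec_orthonormal H x) fun k => 1 / (n : ℝ) * (1 - residual α t (empEig H x k)) ^ 2
  have e : testStat H x α t = fun y : Fin n → ℝ =>
      ∑ k, (1 / (n : ℝ) * (1 - residual α t (empEig H x k)) ^ 2) *
        (∑ i, eigvec H x k i * y i) ^ 2 := funext fun y => testStat_eq H x α t y
  rw [Real.coe_toNNReal _ (sq_nonneg σ), ← e] at h
  exact h

lemma nullSd_eq (σ : ℝ) (α : ℕ → ℝ) (t : ℕ) :
    nullSd H σ x α t = √2 * σ ^ 2 * (1 / (n : ℝ)) *
      √(∑ k, (1 - residual α t (empEig H x k)) ^ 4) := by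
  rw [nullSd, (testStat_moments H x σ α t 0).2.2]
  have e : ∑ k, (1 / (n : ℝ) * (1 - residual α t (empEig H x k)) ^ 2) ^ 2 *
        (4 * coord H x (fun i => (0 : 𝒳 → ℝ) (x i)) k ^ 2 * σ ^ 2 + 2 * (σ ^ 2) ^ 2) =
      2 * (σ ^ 2 * (1 / (n : ℝ))) ^ 2 * ∑ k, (1 - residual α t (empEig H x k)) ^ 4 := by
    rw [Finset.mul_sum]
    refine Finset.sum_congr rfl fun k _ => ?_
    simp [coord]
    ring
  rw [e, Real.sqrt_mul (by positivity), Real.sqrt_mul (by norm_num), Real.sqrt_sq (by positivity)]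
  ring

end Spectral

/-! ### Minimality of the rates at the stopping time. -/

section Rates

variable {𝒳 : Type*} {H : Type*} [NormedAddCommGroup H] [InnerProductSpace ℝ H]
    [CompleteSpace H] [RKHS ℝ H 𝒳 ℝ] {n : ℕ} {x : Fin n → 𝒳} {α : ℕ → ℝ}

lemma IsStepSizes.zero_pos (hα : IsStepSizes H x α) : 0 < α 0 := by
  refine (hα.nonneg 0).lt_of_ne fun h => ?_
  have h0 (τ : ℕ) : α τ = 0 :=
    le_antisymm (h ▸ hα.antitone (Nat.zero_le τ)) (hα.nonneg τ)
  obtain ⟨t, ht⟩ := (hα.diverges.eventually_ge_atTop 1).exists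
  simp [totalStep, h0] at ht
  linarith

lemma IsStepSizes.le_totalStep (hα : IsStepSizes H x α) {t : ℕ} (ht : 0 < t) :
    α 0 ≤ totalStep α t := by
  have h := totalStep_mono hα.nonneg (Nat.succ_le_of_lt ht)
  simpa [totalStep] using h

lemma IsStepSizes.totalStep_pos (hα : IsStepSizes H x α) {t : ℕ} (ht : 0 < t) :
    0 < totalStep α t := hα.zero_pos.trans_le (hα.le_totalStep ht)

/-- The new step is at most α_0, which for t ≥ 1 is already a summand of η_t. -/
lemma IsStepSizes.totalStep_succ_le (hα : IsStepSizes H x α) {t : ℕ} (ht : 0 < t) :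
    totalStep α (t + 1) ≤ 2 * totalStep α t := by
  rw [totalStep_succ]
  linarith [hα.le_totalStep ht, hα.antitone (Nat.zero_le t)]

lemma sdOrder_nonneg (t : ℕ) : 0 ≤ sdOrder H x α t := by
  unfold sdOrder
  positivity

lemma nullSd_nonneg (σ : ℝ) (t : ℕ) : 0 ≤ nullSd H σ x α t := Real.sqrt_nonneg _

lemma sdOrder_mono (hα : IsStepSizes H x α) : Monotone (sdOrder H x α) := fun s t hst => by
  unfold sdOrder
  gcongr with k
  · exact empEig_nonneg H x k
  · exact totalStep_mono hα.nonneg hst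

lemma sdOrder_succ_le (hα : IsStepSizes H x α) {t : ℕ} (ht : 0 < t) :
    sdOrder H x α (t + 1) ≤ 2 * sdOrder H x α t := by
  have h : ∑ i, min 1 (totalStep α (t + 1) * empEig H x i) ≤
      2 ^ 2 * ∑ i, min 1 (totalStep α t * empEig H x i) := by
    rw [Finset.mul_sum]
    refine Finset.sum_le_sum fun k _ => ?_
    have hu := empEig_nonneg H x k
    have h2 := mul_le_mul_of_nonneg_right (hα.totalStep_succ_le ht) hu
    have h0 := mul_nonneg (totalStep_nonneg hα.nonneg t) hu
    rcases le_total 1 (totalStep α t * empEig H x k) with h | h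
    · rw [min_eq_left h]
      exact (min_le_left _ _).trans (by norm_num)
    · rw [min_eq_right h]
      exact (min_le_right _ _).trans (by linarith)
  unfold sdOrder
  calc 1 / (n : ℝ) * √(∑ i, min 1 (totalStep α (t + 1) * empEig H x i))
      ≤ 1 / (n : ℝ) * √(2 ^ 2 * ∑ i, min 1 (totalStep α t * empEig H x i)) := by gcongr
    _ = _ := by
      rw [Real.sqrt_mul (by norm_num), Real.sqrt_sq (by norm_num)]
      ring

lemma nullSd_mono (hα : IsStepSizes H x α) (σ : ℝ) : Monotone (nullSd H σ x α) := fun s t hst => by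
  rw [nullSd_eq, nullSd_eq]
  gcongr with k
  · linarith [residual_le_one hα.nonneg (empEig_nonneg H x k) (fun τ => hα.mul_eig_le τ k) s]
  · exact residual_antitone hα.nonneg (empEig_nonneg H x k) (fun τ => hα.mul_eig_le τ k) hst

/-- Since 0 ≤ 1 - ρ ≤ 1, its fourth power is at most 1 - ρ. Eigenvalues far below 1/η_t lose much
here, so a converse has to be assumed where one is needed. -/
lemma nullSd_le (hα : IsStepSizes H x α) (σ : ℝ) (t : ℕ) :
    nullSd H σ x α t ≤ 2 * σ ^ 2 * sdOrder H x α t := by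
  rw [nullSd_eq, sdOrder, mul_assoc (√2 * σ ^ 2)]
  have h2 : √2 ≤ 2 := Real.sqrt_le_iff.2 ⟨by norm_num, by norm_num⟩
  gcongr with k
  have h0 := residual_le_one hα.nonneg (empEig_nonneg H x k) (fun τ => hα.mul_eig_le τ k) t
  have h1 := residual_nonneg (fun τ => hα.mul_eig_le τ k) t
  exact (pow_le_of_le_one (by linarith) (by linarith) (by norm_num)).trans
    (one_sub_residual_le hα.nonneg (empEig_nonneg H x k) (fun τ => hα.mul_eig_le τ k) t)

/-- A single eigenvalue above 1/η_t suffices: there 1 - ρ ≥ 1/2, so the root of the sum of fourth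
powers is at least 1/4. -/
lemma le_nullSd (hα : IsStepSizes H x α) (σ : ℝ) {t : ℕ} {k : Fin n}
    (hk : 1 ≤ totalStep α t * empEig H x k) : σ ^ 2 ≤ 4 * n * nullSd H σ x α t := by
  have hn : (0 : ℝ) < n := by exact_mod_cast k.pos
  have h1 : 1 / 2 ≤ 1 - residual α t (empEig H x k) := by
    have := residual_mul_le hα.nonneg (empEig_nonneg H x k) (fun τ => hα.mul_eig_le τ k) t
    have := residual_nonneg (fun τ => hα.mul_eig_le τ k) t
    nlinarith
  have h2 : (1 / 4 : ℝ) ≤ √(∑ k, (1 - residual α t (empEig H x k)) ^ 4) := by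
    refine Real.le_sqrt_of_sq_le ?_
    calc (1 / 4 : ℝ) ^ 2 = (1 / 2) ^ 4 := by norm_num
      _ ≤ (1 - residual α t (empEig H x k)) ^ 4 := by gcongr
      _ ≤ _ := Finset.single_le_sum
        (f := fun k => (1 - residual α t (empEig H x k)) ^ 4) (fun i _ => by positivity)
        (Finset.mem_univ k)
  have h3 : (1 : ℝ) ≤ √2 := Real.one_le_sqrt.2 (by norm_num)
  rw [nullSd_eq]
  have e : 4 * n * (√2 * σ ^ 2 * (1 / (n : ℝ)) * √(∑ k, (1 - residual α t (empEig H x k)) ^ 4)) =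
      σ ^ 2 * (4 * (√2 * √(∑ k, (1 - residual α t (empEig H x k)) ^ 4))) := by
    field_simp
  rw [e]
  refine le_mul_of_one_le_right (sq_nonneg σ) ?_
  nlinarith

lemma sdOrder_before_stop (hα : IsStepSizes H x α) {σ : ℝ} (hσ : 0 < σ) {t : ℕ} (ht : 0 < t)
    (h : t < stopTime H σ x α) : sdOrder H x α (stopTime H σ x α) ≤ 2 / σ * (1 / totalStep α t) := by
  obtain ⟨s, hs⟩ := Nat.exists_eq_add_of_lt h
  have hT : stopTime H σ x α = (t + s) + 1 := hs
  have hpos : 0 < t + s := by omega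
  -- t + s is the predecessor of T*, where the bias term still dominates; one further step costs a
  -- factor 2.
  have hnot : t + s ∉ stopSet H σ x α := Nat.notMem_of_lt_sInf (by
    have : stopTime H σ x α = sInf (stopSet H σ x α) := rfl
    omega)
  have h1 : σ * sdOrder H x α (t + s) ≤ 1 / totalStep α (t + s) := by
    by_contra! hc
    exact hnot ⟨hα.totalStep_pos hpos, hc⟩
  have h2 : 1 / totalStep α (t + s) ≤ 1 / totalStep α t :=
    one_div_le_one_div_of_le (hα.totalStep_pos ht) (totalStep_mono hα.nonneg (by omega))
  rw [hT]
  refine (sdOrder_succ_le hα hpos).trans ?_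
  rw [div_mul_eq_mul_div, le_div_iff₀ hσ]
  nlinarith

/-- Under the root, times before T* need the factor 1 + 2/σ and times from T* on need 1 + σ; the
constant covers both. -/
lemma sepOrder_stopTime_le (hα : IsStepSizes H x α) {σ : ℝ} (hσ : 0 < σ)
    (hne : (stopSet H σ x α).Nonempty) {t : ℕ} (ht : 0 < t) :
    sepOrder H x α (stopTime H σ x α) ≤ √(1 + σ + 2 / σ) * sepOrder H x α t := by
  obtain ⟨-, hT⟩ : 0 < totalStep α (stopTime H σ x α) ∧ _ := Nat.sInf_mem hne
  unfold sepOrder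
  rw [← Real.sqrt_mul (by positivity)]
  refine Real.sqrt_le_sqrt ?_
  have hη := one_div_pos.2 (hα.totalStep_pos ht)
  have hs := sdOrder_nonneg (H := H) (x := x) (α := α) t
  have hσ2 : 0 < 2 / σ := by positivity
  rcases lt_or_ge t (stopTime H σ x α) with h | h
  · have h1 := sdOrder_before_stop hα hσ ht h
    have h2 : 1 / totalStep α (stopTime H σ x α) ≤ 1 / totalStep α t :=
      one_div_le_one_div_of_le (hα.totalStep_pos ht) (totalStep_mono hα.nonneg h.le)
    nlinarith [mul_pos hσ hη, mul_nonneg hσ.le hs, mul_nonneg hσ2.le hs]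
  · have h1 := sdOrder_mono hα h
    change 1 / totalStep α (stopTime H σ x α) < σ * sdOrder H x α (stopTime H σ x α) at hT
    nlinarith [mul_le_mul_of_nonneg_left h1 hσ.le, mul_pos hσ hη, mul_pos hσ2 hη,
      mul_nonneg hσ2.le hs]

lemma sepRate_stopTime_le (hα : IsStepSizes H x α) {σ : ℝ} (hσ : 0 < σ)
    (hne : (stopSet H σ x α).Nonempty) {M : ℝ} (hM : 0 < M)
    (hs : sdOrder H x α (stopTime H σ x α) ≤ M * nullSd H σ x α (stopTime H σ x α))
    {t : ℕ} (ht : 0 < t) :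
    sepRate H σ x α (stopTime H σ x α) ≤ √(1 + σ * M + 4 * σ) * sepRate H σ x α t := by
  obtain ⟨-, hT⟩ : 0 < totalStep α (stopTime H σ x α) ∧ _ := Nat.sInf_mem hne
  unfold sepRate
  rw [← Real.sqrt_mul (by positivity)]
  refine Real.sqrt_le_sqrt ?_
  have hη := one_div_pos.2 (hα.totalStep_pos ht)
  have hd := nullSd_nonneg (H := H) (x := x) (α := α) σ t
  have hσM := mul_pos hσ hM
  rcases lt_or_ge t (stopTime H σ x α) with h | h
  · have h1 := sdOrder_before_stop hα hσ ht h
    have h2 : 1 / totalStep α (stopTime H σ x α) ≤ 1 / totalStep α t :=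
      one_div_le_one_div_of_le (hα.totalStep_pos ht) (totalStep_mono hα.nonneg h.le)
    -- The comparability constant M enters only from T* on, where it turns the stopping inequality
    -- into 1/η_{T*} < σM σ_{n,T*}.
    have h3 : nullSd H σ x α (stopTime H σ x α) ≤ 4 * σ * (1 / totalStep α t) :=
      calc nullSd H σ x α (stopTime H σ x α)
          ≤ 2 * σ ^ 2 * sdOrder H x α (stopTime H σ x α) := nullSd_le hα σ _
        _ ≤ 2 * σ ^ 2 * (2 / σ * (1 / totalStep α t)) := by gcongr
        _ = 4 * σ * (1 / totalStep α t) := by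
          field_simp
          ring
    nlinarith [mul_pos hσM hη, mul_nonneg hσ.le hd, mul_nonneg hσM.le hd]
  · have h1 := nullSd_mono hα σ h
    change 1 / totalStep α (stopTime H σ x α) < σ * sdOrder H x α (stopTime H σ x α) at hT
    nlinarith [mul_le_mul_of_nonneg_left hs hσ.le, mul_le_mul_of_nonneg_left h1 hσM.le,
      mul_pos hσ hη, mul_pos hσM hη, mul_nonneg hσ.le hd]

end Rates

/-! ### Power of the test for a fixed design. -/

section Power

variable {𝒳 : Type*} {H : Type*} [NormedAddCommGroup H] [InnerProductSpace ℝ H]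
    [CompleteSpace H] [RKHS ℝ H 𝒳 ℝ] {n : ℕ} {x : Fin n → 𝒳} {α : ℕ → ℝ}

/-- The increase of the mean of the test statistic under the regression function `f`. -/
def meanShift (H : Type*) [NormedAddCommGroup H] [InnerProductSpace ℝ H]
    [CompleteSpace H] [RKHS ℝ H 𝒳 ℝ] (x : Fin n → 𝒳) (α : ℕ → ℝ) (t : ℕ) (f : 𝒳 → ℝ) : ℝ :=
  ∑ k, (1 / (n : ℝ) * (1 - residual α t (empEig H x k)) ^ 2) *
    coord H x (fun i => f (x i)) k ^ 2

lemma integral_testStat (σ : ℝ) (t : ℕ) (f : 𝒳 → ℝ) :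
    ∫ y, testStat H x α t y ∂(obsLaw σ x f) = nullMean H σ x α t + meanShift H x α t f := by
  rw [nullMean, (testStat_moments H x σ α t f).2.1, (testStat_moments H x σ α t 0).2.1, meanShift,
    ← Finset.sum_add_distrib]
  refine Finset.sum_congr rfl fun k _ => ?_
  simp [coord]
  ring

/-- With λ = 1 - ρ, the bound λ⁴ ≤ λ² turns the cross terms of the variance into a multiple of the
mean shift. -/
lemma variance_testStat_le (hα : IsStepSizes H x α) (σ : ℝ) (t : ℕ) (f : 𝒳 → ℝ) :
    variance (testStat H x α t) (obsLaw σ x f) ≤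
      nullSd H σ x α t ^ 2 + 4 * σ ^ 2 * (1 / (n : ℝ)) * meanShift H x α t f := by
  rw [nullSd, Real.sq_sqrt (variance_nonneg _ _), (testStat_moments H x σ α t f).2.2,
    (testStat_moments H x σ α t 0).2.2, meanShift, Finset.mul_sum, ← Finset.sum_add_distrib]
  refine Finset.sum_le_sum fun k _ => ?_
  have h0 := residual_le_one hα.nonneg (empEig_nonneg H x k) (fun τ => hα.mul_eig_le τ k) t
  have h1 := residual_nonneg (fun τ => hα.mul_eig_le τ k) t
  set lam := 1 - residual α t (empEig H x k) with hl
  set c := coord H x (fun i => f (x i)) k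
  have h2 : lam ^ 2 ≤ 1 := pow_le_one₀ (by linarith) (by linarith)
  have h3 := mul_le_mul_of_nonneg_left h2
    (show 0 ≤ 4 * c ^ 2 * σ ^ 2 * (1 / (n : ℝ)) ^ 2 * lam ^ 2 by positivity)
  simp only [coord, Pi.zero_apply, mul_zero, Finset.sum_const_zero]
  nlinarith

lemma le_power (σ a : ℝ) (t : ℕ) (f : 𝒳 → ℝ) (hA : 0 < meanShift H x α t f)
    (hz : stdNormalQuantile (1 - a / 2) * nullSd H σ x α t ≤ meanShift H x α t f / 2) :
    1 - variance (testStat H x α t) (obsLaw σ x f) / (meanShift H x α t f / 2) ^ 2 ≤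
      power H σ a x α t f := by
  have hprob : IsProbabilityMeasure (obsLaw σ x f) := by
    unfold obsLaw
    infer_instance
  have hL := (testStat_moments H x σ α t f).1
  have hm : Measurable (testStat H x α t) := by
    have e : testStat H x α t = fun y => _ := funext (testStat_eq H x α t)
    rw [e]
    unfold coord
    fun_prop
  have hch := meas_ge_le_variance_div_sq hL (half_pos hA)
  rw [integral_testStat] at hch
  set B := {y | meanShift H x α t f / 2 ≤
    |testStat H x α t y - (nullMean H σ x α t + meanShift H x α t f)|} with hB
  have hBm : MeasurableSet B := measurableSet_le measurable_const (by fun_prop)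
  have h1 : (obsLaw σ x f).real B ≤
      variance (testStat H x α t) (obsLaw σ x f) / (meanShift H x α t f / 2) ^ 2 :=
    ENNReal.toReal_le_of_le_ofReal (div_nonneg (variance_nonneg _ _) (sq_nonneg _)) hch
  -- If D is within A/2 of its mean under `f`, it exceeds the null mean by more than A/2, hence by
  -- more than the critical value.
  have h2 : Bᶜ ⊆ {y | test H σ a x α t y = 1} := by
    intro y hy
    have hy' : |testStat H x α t y - (nullMean H σ x α t + meanShift H x α t f)| <
        meanShift H x α t f / 2 := by simpa [hB] using hy
    have hmem : y ∈ {y | stdNormalQuantile (1 - a / 2) * nullSd H σ x α t ≤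
        |testStat H x α t y - nullMean H σ x α t|} := by
      have h3 := (abs_lt.1 hy').1
      have h4 := le_abs_self (testStat H x α t y - nullMean H σ x α t)
      simp only [Set.mem_ofPred_eq]
      linarith
    simp only [Set.mem_ofPred_eq, test, Set.indicator_of_mem hmem, Pi.one_apply]
  have h5 : (obsLaw σ x f).real Bᶜ = 1 - (obsLaw σ x f).real B := probReal_compl_eq_one_sub hBm
  have h6 : (obsLaw σ x f).real Bᶜ ≤ power H σ a x α t f := measureReal_mono h2
  linarith

/-- The bias of gradient descent is at most of order `1 / η_t`, for every design. -/
lemma le_meanShift (hα : IsStepSizes H x α) {t : ℕ} (ht : 0 < totalStep α t) (hn : 0 < n) (f : H) :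
    empSqNorm (fun i => f (x i)) / 2 - ‖f‖ ^ 2 / totalStep α t ≤
      meanShift H x α t (f : 𝒳 → ℝ) := by
  have hn' : (0 : ℝ) < n := by exact_mod_cast hn
  have h := sum_mul_coord_sq_le x f (w := fun k => residual α t (empEig H x k) ^ 2)
    (fun k => sq_nonneg _) (B := 1 / totalStep α t) fun k =>
      residual_sq_mul_le hα.nonneg (empEig_nonneg H x k) (fun τ => hα.mul_eig_le τ k) t ht
  have h1 := mul_le_mul_of_nonneg_left h (one_div_pos.2 hn').le
  have e : 1 / (n : ℝ) * (n * (1 / totalStep α t) * ‖f‖ ^ 2) = ‖f‖ ^ 2 / totalStep α t := by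
    field_simp
  rw [e] at h1
  refine (sub_le_sub_left h1 _).trans ?_
  rw [empSqNorm_eq H x, meanShift, mul_div_assoc, Finset.sum_div, Finset.mul_sum, Finset.mul_sum,
    ← Finset.sum_sub_distrib]
  refine Finset.sum_le_sum fun k _ => ?_
  -- The slack in (1 - ρ)² = 1/2 - ρ² + 2(ρ - 1/2)².
  have h2 := mul_nonneg (mul_nonneg (one_div_pos.2 hn').le
    (sq_nonneg (coord H x (fun i => f (x i)) k)))
    (sq_nonneg (residual α t (empEig H x k) - 1 / 2))
  nlinarith

lemma exists_large_eigenvalue (hn : 0 < n) (f : H) {η : ℝ} (hη : 0 < η)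
    (h : ‖f‖ ^ 2 / η < empSqNorm (fun i => f (x i))) : ∃ k, 1 ≤ η * empEig H x k := by
  by_contra! hc
  have hn' : (0 : ℝ) < n := by exact_mod_cast hn
  have h1 := sum_mul_coord_sq_le x f (w := fun _ => 1) (fun _ => zero_le_one) (B := 1 / η)
    fun k => by
      rw [le_div_iff₀ hη]
      linarith [hc k]
  have h2 := mul_le_mul_of_nonneg_left h1 (one_div_pos.2 hn').le
  have e : 1 / (n : ℝ) * (n * (1 / η) * ‖f‖ ^ 2) = ‖f‖ ^ 2 / η := by
    field_simp
  rw [e] at h2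
  simp only [one_mul] at h2
  rw [empSqNorm_eq H x] at h
  linarith

/-- The left side is at most 17·sd·A ≤ 17A²/L, and 17/L ≤ ε/4 is 68 ≤ Lε. -/
lemma chebyshev_bound {L ε sd A v : ℝ} (hL : 1 ≤ L) (hLε : 68 ≤ L * ε) (hsd : 0 < sd)
    (hA : L * sd ≤ A) (hv : v ≤ 16 * sd) : sd ^ 2 + v * A ≤ ε * (A / 2) ^ 2 := by
  have hsdA : sd ≤ A := (le_mul_of_one_le_left hsd.le hL).trans hA
  have hA0 : 0 ≤ A := hsd.le.trans hsdA
  have h1 : sd * sd ≤ sd * A := mul_le_mul_of_nonneg_left hsdA hsd.le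
  have h2 : v * A ≤ 16 * sd * A := mul_le_mul_of_nonneg_right hv hA0
  have h3 : L * sd * A ≤ A * A := mul_le_mul_of_nonneg_right hA hA0
  have h4 : 68 * (A * A) ≤ L * ε * (A * A) :=
    mul_le_mul_of_nonneg_right hLε (mul_self_nonneg A)
  have h5 : 17 * (sd * A) * L ≤ ε * (A / 2) ^ 2 * L := by linarith
  have h6 := le_of_mul_le_mul_right h5 (by linarith)
  linarith

/-- A lower bound for the power of the test that holds for every design. If no empirical
eigenvalue exceeds `1 / η_t`, then the ball of radius `R` contains no separated alternative;
otherwise the null standard deviation is at least of order `σ² / n`, and Chebyshev's inequality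
applies. -/
lemma one_sub_le_power (hα : IsStepSizes H x α) {σ : ℝ} (hσ : 0 < σ) (hn : 0 < n) {t : ℕ}
    (ht : 0 < t) {a R ε C : ℝ} (hε : 0 < ε) (hC : 0 ≤ C)
    (hCL : C ^ 2 = 4 * (1 + R ^ 2 + 2 * |stdNormalQuantile (1 - a / 2)| + 68 / ε))
    (f : H) (hf : ‖f‖ ≤ R) (hsep : C * sepRate H σ x α t ≤ empNorm x (f : 𝒳 → ℝ)) :
    1 - ε ≤ power H σ a x α t (f : 𝒳 → ℝ) := by
  have hη := hα.totalStep_pos ht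
  have hsd0 := nullSd_nonneg (H := H) (x := x) (α := α) σ t
  have hn' : (0 : ℝ) < n := by exact_mod_cast hn
  set z := stdNormalQuantile (1 - a / 2) with hz
  -- R² absorbs the bias, 2|z| the critical value, and 68/ε the Chebyshev error.
  set L := 1 + R ^ 2 + 2 * |z| + 68 / ε with hL
  set sd := nullSd H σ x α t with hsd
  set A := meanShift H x α t (f : 𝒳 → ℝ) with hA
  have hε' : 0 < 68 / ε := by positivity
  have hL1 : 1 ≤ L := by nlinarith [abs_nonneg z, sq_nonneg R]
  have hLz : 2 * |z| ≤ L := by nlinarith [abs_nonneg z, sq_nonneg R]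
  have hLR : R ^ 2 ≤ L := by nlinarith [abs_nonneg z, sq_nonneg R]
  have hLε : 68 ≤ L * ε := by
    have : 68 / ε ≤ L := by nlinarith [abs_nonneg z, sq_nonneg R]
    rwa [div_le_iff₀ hε] at this
  have hfR : ‖f‖ ^ 2 ≤ R ^ 2 := pow_le_pow_left₀ (norm_nonneg _) hf 2
  have hnorm : 4 * L * (1 / totalStep α t + sd) ≤ empSqNorm (fun i => f (x i)) := by
    have h0 : 0 ≤ empSqNorm (fun i => f (x i)) := by
      unfold empSqNorm
      positivity
    have hrate : sepRate H σ x α t ^ 2 = 1 / totalStep α t + sd := Real.sq_sqrt (by positivity)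
    have hemp : empNorm x (f : 𝒳 → ℝ) ^ 2 = empSqNorm (fun i => f (x i)) := Real.sq_sqrt h0
    have h := pow_le_pow_left₀
      (mul_nonneg hC (show 0 ≤ sepRate H σ x α t from Real.sqrt_nonneg _)) hsep 2
    rwa [mul_pow, hrate, hemp, hCL] at h
  have hη1 := one_div_pos.2 hη
  have hbias : ‖f‖ ^ 2 / totalStep α t ≤ L * (1 / totalStep α t) := by
    rw [div_eq_mul_one_div]
    exact mul_le_mul_of_nonneg_right (hfR.trans hLR) hη1.le
  have hLη : 0 < L * (1 / totalStep α t) := mul_pos (by linarith) hη1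
  have hLsd : 0 ≤ L * sd := mul_nonneg (by linarith) hsd0
  -- Half of ‖f‖_n² is at least 2L(1/η_t + sd), and the bias takes away at most L/η_t.
  have hAL : L * sd ≤ A := by
    have := le_meanShift hα hη hn f
    linarith
  obtain ⟨k, hk⟩ := exists_large_eigenvalue (x := x) hn f hη (by linarith)
  have hσsd : σ ^ 2 * (1 / n) ≤ 4 * sd := by
    have := le_nullSd hα σ hk
    rw [mul_one_div, div_le_iff₀ hn']
    linarith
  have hsd1 : 0 < sd := by
    have : 0 < σ ^ 2 * (1 / n) := by positivity
    linarith
  have hA0 : 0 < A := (mul_pos (by linarith) hsd1).trans_le hAL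
  refine le_trans ?_ (le_power σ a t f hA0 ?_)
  · have hvar := variance_testStat_le hα σ t (f : 𝒳 → ℝ)
    have h1 : variance (testStat H x α t) (obsLaw σ x f) / (A / 2) ^ 2 ≤ ε := by
      rw [div_le_iff₀ (by positivity)]
      refine hvar.trans (chebyshev_bound hL1 hLε hsd1 hAL ?_)
      linarith
    linarith
  · have h1 : z * sd ≤ |z| * sd := mul_le_mul_of_nonneg_right (le_abs_self z) hsd0
    have h2 : 2 * |z| * sd ≤ L * sd := mul_le_mul_of_nonneg_right hLz hsd0
    linarith

end Power

/-! ### Almost sure existence of the stopping time. -/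

section Existence

variable {𝒳 : Type*} {H : Type*} [NormedAddCommGroup H] [InnerProductSpace ℝ H]
    [CompleteSpace H] [RKHS ℝ H 𝒳 ℝ]

lemma kern_self_nonneg (x : 𝒳) : 0 ≤ kern H x x := by
  have h := RKHS.kernel_inner (𝕜 := ℝ) H x x (1 : ℝ) (1 : ℝ)
  have h2 : kern H x x = inner ℝ (RKHS.kerFun H x (1 : ℝ)) (RKHS.kerFun H x (1 : ℝ)) := by
    rw [← h]
    simp [kern]
  rw [h2]
  exact real_inner_self_nonneg

lemma exists_empEig_pos {n : ℕ} (x : Fin n → 𝒳) {i : Fin n} (hi : 0 < kern H (x i) (x i)) :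
    ∃ k, 0 < empEig H x k := by
  have htr := (empKernel_isHermitian H x).trace_eq_sum_eigenvalues
  have hn : (0 : ℝ) < n := by exact_mod_cast i.pos
  have hpos : 0 < (empKernel H x).trace := by
    refine Finset.sum_pos' (fun j _ => ?_) ⟨i, Finset.mem_univ i, ?_⟩
    · exact mul_nonneg (one_div_pos.2 hn).le (kern_self_nonneg _)
    · exact mul_pos (one_div_pos.2 hn) hi
  by_contra! hc
  have : (empKernel H x).trace ≤ 0 := by
    rw [htr]
    exact Finset.sum_nonpos fun k _ => hc k
  linarith

lemma stopSet_nonempty {n : ℕ} {x : Fin n → 𝒳} {α : ℕ → ℝ} (hα : IsStepSizes H x α) {σ : ℝ}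
    (hσ : 0 < σ) {k : Fin n} (hk : 0 < empEig H x k) : (stopSet H σ x α).Nonempty := by
  have hn : (0 : ℝ) < n := by exact_mod_cast k.pos
  -- The first condition makes one summand equal to 1, so s ≥ 1/n; the second gives 1/η_t < σ/n.
  obtain ⟨t, ⟨h1, h2⟩, h3⟩ := (((hα.diverges.eventually_ge_atTop (1 / empEig H x k)).and
    (hα.diverges.eventually_gt_atTop (n / σ))).and (hα.diverges.eventually_gt_atTop 0)).exists
  rw [div_le_iff₀ hk] at h1
  rw [div_lt_iff₀ hσ] at h2
  refine ⟨t, h3, ?_⟩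
  have h4 : 1 / (n : ℝ) ≤ sdOrder H x α t := by
    unfold sdOrder
    refine le_mul_of_one_le_right (one_div_pos.2 hn).le (Real.one_le_sqrt.2 ?_)
    calc (1 : ℝ) = min 1 (totalStep α t * empEig H x k) := (min_eq_left h1).symm
      _ ≤ _ := Finset.single_le_sum (f := fun i => min 1 (totalStep α t * empEig H x i))
        (fun i _ => le_min zero_le_one (mul_nonneg h3.le (empEig_nonneg H x i)))
        (Finset.mem_univ k)
  refine lt_of_lt_of_le ?_ (mul_le_mul_of_nonneg_left h4 hσ.le)
  rw [mul_one_div, div_lt_div_iff₀ h3 hn]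
  linarith

/-- If μ_j ≤ 0, then j lies in the set defining κ_t whenever η_t > 0, and κ_t stays at most j. -/
lemma eigenvalue_pos_of_kappa {μ α : ℕ → ℝ} (hα : Tendsto (totalStep α) atTop atTop)
    (hκ : Tendsto (kappa μ α) atTop atTop) (j : ℕ) : 0 < μ j := by
  obtain ⟨t, h1, h2⟩ := ((hα.eventually_gt_atTop 0).and (hκ.eventually_gt_atTop j)).exists
  have h3 : ¬ μ j < 1 / totalStep α t := Nat.notMem_of_lt_sInf h2
  exact (one_div_pos.2 h1).trans_le (not_lt.1 h3)

/-- Almost every point is in the support of some element of an orthonormal basis of `L²`. -/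
lemma ae_exists_hilbertBasis_ne_zero {ι : Type*} [Countable ι] [MeasurableSpace 𝒳] {P : Measure 𝒳}
    [IsProbabilityMeasure P] (b : HilbertBasis ι ℝ (Lp ℝ 2 P)) : ∀ᵐ x ∂P, ∃ i, b i x ≠ 0 := by
  set Z := {x | ∀ i, b i x = 0} with hZ
  have hZm : MeasurableSet Z := by
    have : Z = ⋂ i, {x | b i x = 0} := by
      ext x
      simp [hZ]
    rw [this]
    exact MeasurableSet.iInter fun i =>
      (Lp.stronglyMeasurable (b i)).measurable (measurableSet_singleton 0)
  -- The indicator of the common zero set is orthogonal to every basis element, hence zero in L².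
  have hinner (i : ι) :
      inner ℝ (b i) (indicatorConstLp 2 hZm (measure_ne_top P Z) (1 : ℝ)) = 0 := by
    rw [real_inner_comm, L2.inner_indicatorConstLp_one]
    exact setIntegral_eq_zero_of_forall_eq_zero fun x hx => hx i
  have hzero : indicatorConstLp 2 hZm (measure_ne_top P Z) (1 : ℝ) = 0 := by
    refine b.repr.injective (lp.ext (funext fun i => ?_))
    rw [b.repr_apply_apply, hinner, map_zero]
    rfl
  have hPZ : P Z = 0 := by
    have h := norm_indicatorConstLp (p := 2) (hs := hZm) (hμs := measure_ne_top P Z) (c := (1 : ℝ))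
      (by simp) (by simp)
    rw [hzero, norm_zero, norm_one, one_mul] at h
    have h2 := (Real.rpow_eq_zero measureReal_nonneg (by simp)).1 h.symm
    exact (measureReal_eq_zero_iff (measure_ne_top P Z)).1 h2
  rw [ae_iff]
  convert hPZ using 2
  simp [hZ]

lemma SpectralExpansion.ae_kern_self_pos [MeasurableSpace 𝒳] {P : Measure 𝒳}
    [IsProbabilityMeasure P] (S : SpectralExpansion H P) (hμ : ∀ j, 0 < S.μ j) :
    ∀ᵐ x ∂P, 0 < kern H x x := by
  filter_upwards [ae_exists_hilbertBasis_ne_zero S.basis, ae_all_iff.2 S.basis_ae] with x hx he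
  obtain ⟨i, hi⟩ := hx
  rw [he i] at hi
  have hnn (j : ℕ) : 0 ≤ S.μ j * S.φ j x * S.φ j x := by
    rw [mul_assoc]
    exact mul_nonneg (S.nonneg j) (mul_self_nonneg _)
  have h := le_hasSum (S.expansion x x) i fun j _ => hnn j
  refine lt_of_lt_of_le ?_ h
  rw [mul_assoc]
  exact mul_pos (hμ i) (mul_self_pos.2 hi)

end Existence

end GDTest

end

theorem theorem2 {𝒳 : Type*} [MeasurableSpace 𝒳]
    -- the RKHS, contained in `L²(P)`, and the spectral expansion of its kernel
    (H : Type*) [NormedAddCommGroup H] [InnerProductSpace ℝ H] [CompleteSpace H] [RKHS ℝ H 𝒳 ℝ]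
    (P : Measure 𝒳) [IsProbabilityMeasure P]
    (hHL2 : ∀ f : H, MemLp (f : 𝒳 → ℝ) 2 P)
    (S : GDTest.SpectralExpansion H P)
    (hbdd : ∃ cK : ℝ, ∀ i x, |S.φ i x| ≤ cK)
    -- the random design: i.i.d. covariates with law `P`
    {Ω : Type*} [MeasurableSpace Ω] (Pr : Measure Ω) [IsProbabilityMeasure Pr]
    (X : ℕ → Ω → 𝒳) (hX : ∀ i, Measurable (X i)) (hXlaw : ∀ i, Pr.map (X i) = P)
    (hXindep : iIndepFun X Pr)
    -- the noise level
    (σ : ℝ) (hσ : 0 < σ)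
    -- the step sizes, which may depend on the sample size and on the design
    (α : ∀ n : ℕ, (Fin n → 𝒳) → ℕ → ℝ)
    (hα : ∀ (n : ℕ) (x : Fin n → 𝒳), GDTest.IsStepSizes H x (α n x))
    (hκ : ∀ (n : ℕ) (x : Fin n → 𝒳), Tendsto (GDTest.kappa S.μ (α n x)) atTop atTop) :
    -- (a)
    (∃ c : ℝ, 0 < c ∧ ∀ a : ℝ, 0 < a → a < 1 → ∀ R : ℝ, 0 < R → ∀ ε : ℝ, 0 < ε →
      ∃ (Cε : ℝ) (tε Nε : ℕ), 0 < Cε ∧ 0 < tε ∧ 0 < Nε ∧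
        ∀ T : ℕ, tε ≤ T → ∃ E : Set Ω, MeasurableSet E ∧
          (∀ n : ℕ, Nε ≤ n → ∀ x : Fin n → 𝒳,
            1 - Real.exp (-(c * (GDTest.kappa S.μ (α n x) T : ℝ))) < Pr.real E) ∧
          ∀ ω ∈ E, ∀ t : ℕ, T ≤ t → ∀ n : ℕ, Nε ≤ n →
            ∀ x : Fin n → 𝒳, x = (fun i : Fin n => X i ω) →
              ∀ f : H, ‖f‖ ≤ R →
                Cε * GDTest.sepRate H σ x (α n x) t ≤ GDTest.empNorm x (f : 𝒳 → ℝ) →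
                  1 - ε ≤ GDTest.power H σ a x (α n x) t (f : 𝒳 → ℝ)) ∧
    -- (b) almost surely, the stopping time exists for every sample size
    (∀ᵐ ω ∂Pr, ∀ n : ℕ, 0 < n →
      (GDTest.stopSet H σ (fun i : Fin n => X i ω) (α n fun i : Fin n => X i ω)).Nonempty) ∧
    -- the explicit form of the separation rate is minimal at the stopping time, up to a constant
    (∃ C₀ : ℝ, 0 < C₀ ∧ ∀ n : ℕ, 0 < n → ∀ x : Fin n → 𝒳,
      (GDTest.stopSet H σ x (α n x)).Nonempty → ∀ t : ℕ, 0 < t →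
        GDTest.sepOrder H x (α n x) (GDTest.stopTime H σ x (α n x)) ≤
          C₀ * GDTest.sepOrder H x (α n x) t) ∧
    -- so is `d_{n,t}`, where its two forms have the same order at the stopping time
    (∀ M : ℝ, 0 < M → ∃ C₁ : ℝ, 0 < C₁ ∧ ∀ n : ℕ, 0 < n → ∀ x : Fin n → 𝒳,
      (GDTest.stopSet H σ x (α n x)).Nonempty →
        GDTest.sdOrder H x (α n x) (GDTest.stopTime H σ x (α n x)) ≤
          M * GDTest.nullSd H σ x (α n x) (GDTest.stopTime H σ x (α n x)) →
          ∀ t : ℕ, 0 < t →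
            GDTest.sepRate H σ x (α n x) (GDTest.stopTime H σ x (α n x)) ≤
              C₁ * GDTest.sepRate H σ x (α n x) t) := by
  -- The μ_j do not depend on the sample, so the empty design already shows their positivity.
  have hμ : ∀ j, 0 < S.μ j :=
    GDTest.eigenvalue_pos_of_kappa (hα 0 Fin.elim0).diverges (hκ 0 Fin.elim0)
  refine ⟨⟨1, one_pos, fun a _ _ R hR ε hε => ?_⟩, ?_, ?_, ?_⟩
  · have hL : 0 < 1 + R ^ 2 + 2 * |GDTest.stdNormalQuantile (1 - a / 2)| + 68 / ε := by positivity
    have hC := mul_pos (by norm_num : (0 : ℝ) < 4) hL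
    refine ⟨√(4 * (1 + R ^ 2 + 2 * |GDTest.stdNormalQuantile (1 - a / 2)| + 68 / ε)), 1, 1,
      Real.sqrt_pos.2 hC, one_pos, one_pos, fun T hT => ⟨Set.univ, MeasurableSet.univ, ?_, ?_⟩⟩
    · intro n _ x
      rw [probReal_univ]
      linarith [Real.exp_pos (-(1 * (GDTest.kappa S.μ (α n x) T : ℝ)))]
    · intro ω _ t ht n hn x _ f hf hsep
      exact GDTest.one_sub_le_power (hα n x) hσ hn (hT.trans ht) hε (Real.sqrt_nonneg _)
        (Real.sq_sqrt hC.le) f hf hsep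
  · have hX0 : ∀ᵐ ω ∂Pr, 0 < GDTest.kern H (X 0 ω) (X 0 ω) := by
      have h := S.ae_kern_self_pos hμ
      rw [← hXlaw 0] at h
      exact ae_of_ae_map (hX 0).aemeasurable h
    filter_upwards [hX0] with ω hω n hn
    -- The first covariate alone makes the trace positive, so one null set serves all n ≥ 1.
    obtain ⟨k, hk⟩ := GDTest.exists_empEig_pos (H := H) (fun i : Fin n => X i ω) (i := ⟨0, hn⟩) hω
    exact GDTest.stopSet_nonempty (hα n _) hσ hk
  · exact ⟨√(1 + σ + 2 / σ), Real.sqrt_pos.2 (by positivity), fun n _ x hne t ht =>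
      GDTest.sepOrder_stopTime_le (hα n x) hσ hne ht⟩
  · intro M hM
    exact ⟨√(1 + σ * M + 4 * σ), Real.sqrt_pos.2 (by positivity), fun n _ x hne hs t ht =>
      GDTest.sepRate_stopTime_le (hα n x) hσ hne hM hs ht⟩
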